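/- All graphs are finite, undirected, without loops or multiple edges. For a graph $G=(V,E)$ let $n(G)=|V|$, $m(G)=|E|$, let $\alpha(G)$ be the maximum size of an independent set and $\mu(G)$ the maximum size of a matching. $G$ is a König–Egerváry graph if $\alpha(G)+\mu(G)=n(G)$. For $A\subseteq V$ let $N(A)$ be the set of vertices having a neighbor in $A$, and let $d(G)=\max\{|X|-|N(X)| : X\subseteq V\}$. An independent set $A$ is critical if $|A|-|N(A)|=d(G)$. Let $\mathrm{core}(G)$ be the intersection of all maximum independent sets and $\ker(G)$ the intersection of all critical independent sets of $G$; put $\xi(G)=|\mathrm{core}(G)|$ and $\varepsilon(G)=|\ker(G)|$. For $A,B\subseteq V$ let $(A,B)$ be the set of edges $ab\in E$ with $a\in A$, $b\in B$. An edge $e$ is $\mu$-critical if $\mu(G-e)<\mu(G)$. Let $\varrho_e(G)$ be the number of edges $e\in E$ such that $G-e$ is a König–Egerváry graph. **Theorem.** If $G$ is a König–Egerváry graph, then (i) there are no $\mu$-critical edges of $G$ in $(\ker(G),N(\ker(G)))$; (ii) there are no $\mu$-critical edges of $G$ in $(\mathrm{core}(G)-\ker(G),N(\ker(G)))$; (iii)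 every $\mu$-critical edge of $G$ in $(\mathrm{core}(G),N(\mathrm{core}(G)))$ lies in $(\mathrm{core}(G)-\ker(G),\,N(\mathrm{core}(G))-N(\ker(G)))$; (iv) the maximum possible number of $\mu$-critical edges in $(\mathrm{core}(G),N(\mathrm{core}(G)))$ is $\xi(G)-\varepsilon(G)$: there are at most $\xi(G)-\varepsilon(G)$ such edges in $G$, and there is a König–Egerváry graph $H$ with $\xi(H)=\xi(G)$ and $\varepsilon(H)=\varepsilon(G)$ having exactly $\xi(H)-\varepsilon(H)$ $\mu$-critical edges in $(\mathrm{core}(H),N(\mathrm{core}(H)))$; (v) $\varrho_e(G)\ge m(G)-\xi(G)+\varepsilon(G)$. -/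

import Mathlib

namespace KonigEgervary

variable {V : Type*}

/-- The neighborhood `N(A)`: the vertices having at least one neighbor in `A`. -/
def nbhd (G : SimpleGraph V) (A : Set V) : Set V :=
  {v | (G.neighborSet v ∩ A).Nonempty}

/-- The set `(A, B)` of the edges of `G` with one end in `A` and the other end in `B`. -/
def edgesBetween (G : SimpleGraph V) (A B : Set V) : Set (Sym2 V) :=
  {e | e ∈ G.edgeSet ∧ ∃ a ∈ A, ∃ b ∈ B, e = s(a, b)}

/-- The matching number `μ(G)`: the largest number of edges of a matching of `G`. -/
noncomputable def matchingNumber (G : SimpleGraph V) : ℕ :=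
  sSup {n | ∃ M : G.Subgraph, M.IsMatching ∧ M.edgeSet.ncard = n}

theorem bddAbove_matching [Finite V] (G : SimpleGraph V) :
    BddAbove {n | ∃ M : G.Subgraph, M.IsMatching ∧ M.edgeSet.ncard = n} := by
  refine ⟨G.edgeSet.ncard, ?_⟩
  rintro n ⟨M, -, rfl⟩
  exact Set.ncard_le_ncard M.edgeSet_subset (Set.toFinite _)

/-- Every matching has at most `μ(G)` edges. -/
theorem ncard_le_matchingNumber [Finite V] {G : SimpleGraph V} {M : G.Subgraph}
    (hM : M.IsMatching) : M.edgeSet.ncard ≤ matchingNumber G :=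
  le_csSup (bddAbove_matching G) ⟨M, hM, rfl⟩

/-- The value `μ(G)` is attained by some matching. -/
theorem exists_maximum_matching [Finite V] (G : SimpleGraph V) :
    ∃ M : G.Subgraph, M.IsMatching ∧ M.edgeSet.ncard = matchingNumber G :=
  Nat.sSup_mem (s := {n | ∃ M : G.Subgraph, M.IsMatching ∧ M.edgeSet.ncard = n})
    ⟨0, ⊥, by intro v hv; exact hv.elim, by simp⟩ (bddAbove_matching G)

/-- An edge `e` of `G` is `μ`-critical if `μ(G - e) < μ(G)`. -/
def IsMuCritical (G : SimpleGraph V) (e : Sym2 V) : Prop :=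
  e ∈ G.edgeSet ∧ matchingNumber (G.deleteEdges {e}) < matchingNumber G

/-- `G` is a König–Egerváry graph: `α(G) + μ(G) = |V(G)|`. -/
def IsKonigEgervary [Fintype V] (G : SimpleGraph V) : Prop :=
  G.indepNum + matchingNumber G = Fintype.card V

/-- The difference `d(X) = |X| - |N(X)|`. -/
noncomputable def difference (G : SimpleGraph V) (X : Finset V) : ℤ :=
  (X.card : ℤ) - ((nbhd G (X : Set V)).ncard : ℤ)

/-- The critical difference `d(G)`: the maximum of `d(X)` over all sets `X` of vertices. -/
noncomputable def criticalDifference [Fintype V] (G : SimpleGraph V) : ℤ :=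
  (Finset.univ : Finset (Finset V)).sup' Finset.univ_nonempty (difference G)

/-- A critical independent set: an independent set `A` with `d(A) = d(G)`. -/
def IsCriticalIndepSet [Fintype V] (G : SimpleGraph V) (A : Finset V) : Prop :=
  G.IsIndepSet (A : Set V) ∧ difference G A = criticalDifference G

/-- `core(G)`: the intersection of all maximum independent sets. -/
def core [Fintype V] (G : SimpleGraph V) : Set V :=
  {v | ∀ S : Finset V, G.IsMaximumIndepSet S → v ∈ S}

/-- `ker(G)`: the intersection of all critical independent sets. -/
def ker [Fintype V] (G : SimpleGraph V) : Set V :=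
  {v | ∀ A : Finset V, IsCriticalIndepSet G A → v ∈ A}

/-- `ξ(G) = |core(G)|`. -/
noncomputable def xi [Fintype V] (G : SimpleGraph V) : ℕ := (core G).ncard

/-- `ε(G) = |ker(G)|`. -/
noncomputable def eps [Fintype V] (G : SimpleGraph V) : ℕ := (ker G).ncard

/-- The number `m(G)` of edges. -/
noncomputable def numEdges (G : SimpleGraph V) : ℕ := G.edgeSet.ncard

/-- `ϱ_e(G)`: the number of edges `e` of `G` such that `G - e` is König–Egerváry. -/
noncomputable def rhoE [Fintype V] (G : SimpleGraph V) : ℕ :=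
  {e | e ∈ G.edgeSet ∧ IsKonigEgervary (G.deleteEdges {e})}.ncard

/-- The number of `μ`-critical edges of `G` in `(core(G), N(core(G)))`. -/
noncomputable def numCoreMuCritical [Fintype V] (G : SimpleGraph V) : ℕ :=
  {e | e ∈ edgesBetween G (core G) (nbhd G (core G)) ∧ IsMuCritical G e}.ncard

end KonigEgervary

/-! ### Matchings as sets of disjoint edges, covers and exchange. -/

namespace KonigEgervary

open Finset

variable {V : Type*}

/-! Supermodularity of `|X| - |N(X)|` makes `ker(G)` the least critical independent set `K`. By
minimality and Hall's theorem, `N(K)` is matched into `K - a` for every vertex `a`. Exchanging this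
for the edges of a maximum matching that meet `N(K)` gives a maximum matching avoiding any
prescribed edge `ab` with `b ∈ N(K)`, whence (i), (ii) and (iii)
(`not_isMuCritical_of_mem_nbhd_ker`).

Critical edges lie in every maximum matching, so they are disjoint. Those counted in (iv) each have
an end in `core - ker`, and `ker ⊆ core` because maximum independent sets of a König–Egerváry graph
are critical. Disjoint paws and isolated vertices attain the bound.

For (v), if `G - e` is not König–Egerváry, then `e` is critical, and it meets the core: otherwise
both ends lie in maximum independent sets, and `deleteEdges_of_mem` applies. -/

/-- A finite set of pairwise disjoint edges of `G`. -/
def IsEdgeMatching (G : SimpleGraph V) (F : Finset (Sym2 V)) : Prop :=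
  (∀ e ∈ F, e ∈ G.edgeSet) ∧ ∀ e ∈ F, ∀ f ∈ F, ∀ v, v ∈ e → v ∈ f → e = f

theorem IsEdgeMatching.card_le_matchingNumber [Finite V] {G : SimpleGraph V}
    {F : Finset (Sym2 V)} (hF : IsEdgeMatching G F) : F.card ≤ matchingNumber G := by
  let M : G.Subgraph :=
    { verts := {v | ∃ e ∈ F, v ∈ e}
      Adj := fun v w => s(v, w) ∈ F
      adj_sub := fun {v w} h => hF.1 _ h
      edge_vert := fun {v w} h => ⟨_, h, Sym2.mem_mk_left v w⟩
      symm := ⟨fun v w h => by rwa [Sym2.eq_swap]⟩ }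
  have hM : M.IsMatching := by
    rintro v ⟨e, he, hv⟩
    obtain ⟨w, rfl⟩ := Sym2.mem_iff_exists.1 hv
    refine ⟨w, he, fun u hu => ?_⟩
    have := hF.2 _ hu _ he v (Sym2.mem_mk_left _ _) (Sym2.mem_mk_left _ _)
    exact Sym2.congr_right.1 this
  have hE : M.edgeSet = (F : Set (Sym2 V)) := by
    ext e
    induction e with
    | _ v w => rfl
  have := ncard_le_matchingNumber hM
  rwa [hE, Set.ncard_coe_finset] at this

theorem exists_isEdgeMatching_card_eq [Finite V] (G : SimpleGraph V) :
    ∃ F, IsEdgeMatching G F ∧ F.card = matchingNumber G := by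
  obtain ⟨M, hM, hc⟩ := exists_maximum_matching G
  have hfin : M.edgeSet.Finite := Set.toFinite _
  refine ⟨hfin.toFinset, ⟨fun e he => M.edgeSet_subset (hfin.mem_toFinset.1 he), ?_⟩, ?_⟩
  · intro e he f hf v hve hvf
    rw [hfin.mem_toFinset] at he hf
    obtain ⟨w, rfl⟩ := Sym2.mem_iff_exists.1 hve
    obtain ⟨u, rfl⟩ := Sym2.mem_iff_exists.1 hvf
    have h1 : M.Adj v w := he
    have h2 : M.Adj v u := hf
    rw [(hM (M.edge_vert h1)).unique h1 h2]
  · rw [← hc, Set.ncard_eq_toFinset_card _ hfin]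

theorem IsEdgeMatching.mono {G H : SimpleGraph V} {F : Finset (Sym2 V)} (h : G ≤ H)
    (hF : IsEdgeMatching G F) : IsEdgeMatching H F :=
  ⟨fun e he => SimpleGraph.edgeSet_mono h (hF.1 e he), hF.2⟩

theorem matchingNumber_mono [Finite V] {G H : SimpleGraph V} (h : G ≤ H) :
    matchingNumber G ≤ matchingNumber H := by
  obtain ⟨F, hF, hc⟩ := exists_isEdgeMatching_card_eq G
  exact hc ▸ (hF.mono h).card_le_matchingNumber

/-- A `μ`-critical edge belongs to every maximum matching. -/
theorem IsMuCritical.mem [Finite V] {G : SimpleGraph V} {e : Sym2 V} (he : IsMuCritical G e)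
    {F : Finset (Sym2 V)} (hF : IsEdgeMatching G F) (hc : F.card = matchingNumber G) : e ∈ F := by
  by_contra h
  have : IsEdgeMatching (G.deleteEdges {e}) F := by
    refine ⟨fun f hf => ?_, hF.2⟩
    rw [SimpleGraph.edgeSet_deleteEdges]
    exact ⟨hF.1 f hf, fun h' => h (h' ▸ hf)⟩
  exact absurd this.card_le_matchingNumber (by rw [hc]; exact not_le.2 he.2)

theorem IsEdgeMatching.exists_injOn {G : SimpleGraph V} {F : Finset (Sym2 V)}
    (hF : IsEdgeMatching G F) {W : Finset V} (h : ∀ e ∈ F, ∃ v ∈ W, v ∈ e) :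
    ∃ c : Sym2 V → V, (∀ e ∈ F, c e ∈ W ∧ c e ∈ e) ∧ Set.InjOn c F := by
  rcases isEmpty_or_nonempty V with _ | _
  · exact ⟨fun e => e.out.1, fun e => isEmptyElim e.out.1, fun e => isEmptyElim e.out.1⟩
  choose! c hc using h
  exact ⟨c, hc, fun e he f hf hef => hF.2 e he f hf (c e) (hc e he).2 (hef ▸ (hc f hf).2)⟩

/-- A matching has at most as many edges as a vertex cover has vertices. -/
theorem IsEdgeMatching.card_le_of_cover {G : SimpleGraph V} {F : Finset (Sym2 V)}
    (hF : IsEdgeMatching G F) {W : Finset V} (h : ∀ e ∈ F, ∃ v ∈ W, v ∈ e) :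
    F.card ≤ W.card := by
  obtain ⟨c, hc, hinj⟩ := hF.exists_injOn h
  exact card_le_card_of_injOn c (fun e he => (hc e he).1) hinj

/-- If a cover has as many vertices as the matching has edges, then each of its vertices is
matched to a vertex outside the cover. -/
theorem IsEdgeMatching.exists_partner {G : SimpleGraph V} {F : Finset (Sym2 V)}
    (hF : IsEdgeMatching G F) {W : Finset V} (h : ∀ e ∈ F, ∃ v ∈ W, v ∈ e)
    (hcard : F.card = W.card) {v : V} (hv : v ∈ W) : ∃ w ∉ W, s(v, w) ∈ F := by
  classical
  obtain ⟨c, hc, hinj⟩ := hF.exists_injOn h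
  have himg : F.image c = W :=
    -- Equal cardinalities make `c` a bijection onto `W`, so an edge with both ends in `W` would be
    -- chosen by both ends and be a loop.
    eq_of_subset_of_card_le (image_subset_iff.2 fun e he => (hc e he).1)
      (by rw [card_image_of_injOn hinj, hcard])
  have key : ∀ v ∈ W, ∃ e ∈ F, c e = v := fun v hv => by simpa [← himg] using hv
  obtain ⟨e, he, rfl⟩ := key v hv
  obtain ⟨w, hw⟩ := Sym2.mem_iff_exists.1 (hc e he).2
  refine ⟨w, fun hwW => ?_, hw ▸ he⟩
  obtain ⟨f, hf, rfl⟩ := key w hwW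
  have hfe : f = e := hF.2 f hf e he (c f) (hc f hf).2 (hw ▸ Sym2.mem_mk_right _ _)
  have hadj := hF.1 e he
  rw [hw, hfe] at hadj
  exact G.loopless.irrefl _ hadj

/-- An injection of `Y` into its complement along edges gives a matching with `|Y|` edges. -/
theorem isEdgeMatching_image [DecidableEq V] {G : SimpleGraph V} {Y : Finset V} {f : V → V}
    (hf : ∀ y ∈ Y, f y ∉ Y) (hinj : Set.InjOn f Y) (hadj : ∀ y ∈ Y, G.Adj y (f y)) :
    IsEdgeMatching G (Y.image fun y => s(y, f y)) ∧
      (Y.image fun y => s(y, f y)).card = Y.card := by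
  have hne : ∀ y ∈ Y, ∀ z ∈ Y, y ≠ f z := fun y hy z hz h => hf z hz (h ▸ hy)
  refine ⟨⟨fun e he => ?_, fun e he g hg v hve hvg => ?_⟩,
    card_image_of_injOn fun y hy z hz h => ?_⟩
  · obtain ⟨y, hy, rfl⟩ := mem_image.1 he
    exact hadj y hy
  · obtain ⟨y, hy, rfl⟩ := mem_image.1 he
    obtain ⟨z, hz, rfl⟩ := mem_image.1 hg
    rcases Sym2.mem_iff.1 hve with rfl | rfl <;> rcases Sym2.mem_iff.1 hvg with h | h
    · rw [h]
    · exact absurd h (hne _ hy _ hz)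
    · exact absurd h.symm (hne _ hz _ hy)
    · rw [hinj hy hz h]
  · rcases Sym2.eq_iff.1 h with ⟨h, -⟩ | ⟨h, -⟩
    · exact h
    · exact absurd h (hne y hy z hz)

/-- Exchange: the matching edges meeting `Y` are replaced by an injection of `Y` into `X`. -/
theorem IsEdgeMatching.card_le_of_exchange [Finite V] {G G' : SimpleGraph V}
    {F : Finset (Sym2 V)} (hF : IsEdgeMatching G F) {X Y : Finset V} (hXY : Disjoint X Y)
    (hmeet : ∀ e ∈ F, ∀ x ∈ X, x ∈ e → ∃ y ∈ Y, y ∈ e)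
    (hG' : ∀ e ∈ F, (∀ y ∈ Y, y ∉ e) → e ∈ G'.edgeSet)
    (f : V → V) (hfX : ∀ y ∈ Y, f y ∈ X) (hinj : Set.InjOn f Y) (hadj : ∀ y ∈ Y, G'.Adj y (f y)) :
    F.card ≤ matchingNumber G' := by
  classical
  -- `A` is discarded, `B` is kept, and `C` is the replacement. `Y` covers `A`, so `|A| ≤ |Y| =
  -- |C|`.
  set A := F.filter fun e => ∃ y ∈ Y, y ∈ e with hA
  set B := F.filter fun e => ¬ ∃ y ∈ Y, y ∈ e with hB
  set C := Y.image fun y => s(y, f y) with hC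
  obtain ⟨hCm, hCY⟩ : IsEdgeMatching G' C ∧ C.card = Y.card :=
    isEdgeMatching_image (fun y hy => disjoint_left.1 hXY (hfX y hy)) hinj hadj
  have hAY : A.card ≤ Y.card :=
    IsEdgeMatching.card_le_of_cover (G := G)
      ⟨fun e he => hF.1 e (mem_filter.1 he).1,
        fun e he g hg => hF.2 e (mem_filter.1 he).1 g (mem_filter.1 hg).1⟩
      fun e he => (mem_filter.1 he).2
  have hBC : ∀ e ∈ B, ∀ g ∈ C, ∀ v, v ∈ e → v ∈ g → False := by
    intro e he g hg v hve hvg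
    obtain ⟨heF, hno⟩ := mem_filter.1 he
    obtain ⟨y, hy, rfl⟩ := mem_image.1 hg
    rcases Sym2.mem_iff.1 hvg with rfl | rfl
    · exact hno ⟨_, hy, hve⟩
    · exact hno (hmeet e heF _ (hfX y hy) hve)
  have hmatch : IsEdgeMatching G' (B ∪ C) := by
    refine ⟨fun e he => ?_, fun e he g hg v hve hvg => ?_⟩
    · rcases mem_union.1 he with he | he
      · obtain ⟨heF, hno⟩ := mem_filter.1 he
        exact hG' e heF fun y hy hye => hno ⟨y, hy, hye⟩
      · exact hCm.1 e he
    · rcases mem_union.1 he with he | he <;> rcases mem_union.1 hg with hg | hg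
      · exact hF.2 e (mem_filter.1 he).1 g (mem_filter.1 hg).1 v hve hvg
      · exact (hBC e he g hg v hve hvg).elim
      · exact (hBC g hg e he v hvg hve).elim
      · exact hCm.2 e he g hg v hve hvg
  have hdisj : Disjoint B C := disjoint_left.2 fun e he he' => by
    induction e with
    | _ a b => exact hBC _ he _ he' a (Sym2.mem_mk_left _ _) (Sym2.mem_mk_left _ _)
  have hsum : A.card + B.card = F.card := card_filter_add_card_filter_not _
  have := hmatch.card_le_matchingNumber
  rw [card_union_of_disjoint hdisj] at this
  omega

theorem exists_notMem_of_isIndepSet {G : SimpleGraph V} {S : Finset V} (hS : G.IsIndepSet (S : Set V))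
    {e : Sym2 V} (he : e ∈ G.edgeSet) : ∃ v, v ∉ S ∧ v ∈ e := by
  induction e with
  | _ a b =>
    by_cases ha : a ∈ S
    · refine ⟨b, fun hb => ?_, Sym2.mem_mk_right _ _⟩
      have hab : G.Adj a b := he
      exact hS ha hb hab.ne hab
    · exact ⟨a, ha, Sym2.mem_mk_left _ _⟩

theorem mem_nbhd {G : SimpleGraph V} {A : Set V} {v : V} : v ∈ nbhd G A ↔ ∃ w ∈ A, G.Adj v w :=
  ⟨fun ⟨w, h, hA⟩ => ⟨w, hA, h⟩, fun ⟨w, hA, h⟩ => ⟨w, h, hA⟩⟩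

/-! ### Maximum independent sets and critical sets in König–Egerváry graphs. -/

section Fintype

variable [Fintype V] {G : SimpleGraph V}

theorem indepNum_add_matchingNumber_le (G : SimpleGraph V) :
    G.indepNum + matchingNumber G ≤ Fintype.card V := by
  classical
  obtain ⟨S, hS⟩ := G.exists_isNIndepSet_indepNum
  obtain ⟨F, hF, hc⟩ := exists_isEdgeMatching_card_eq G
  have := hF.card_le_of_cover (W := Sᶜ) fun e he => by
    simpa using exists_notMem_of_isIndepSet hS.isIndepSet (hF.1 e he)
  rw [card_compl, hS.card_eq, hc] at this
  have h2 : G.indepNum ≤ Fintype.card V := hS.card_eq ▸ card_le_univ S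
  omega

theorem card_eq_indepNum {S : Finset V} (hS : G.IsMaximumIndepSet S) :
    S.card = G.indepNum :=
  SimpleGraph.maximumIndepSet_card_eq_indepNum S hS

theorem isMaximumIndepSet_of_card_eq {S : Finset V} (hS : G.IsIndepSet (S : Set V))
    (hc : S.card = G.indepNum) : G.IsMaximumIndepSet S :=
  ⟨hS, fun _ hT => hc ▸ hT.card_le_indepNum⟩

/-- In a König–Egerváry graph every maximum matching matches the complement of every maximum
independent set into this set. -/
theorem IsKonigEgervary.exists_partner (hG : IsKonigEgervary G) {S : Finset V}
    (hS : G.IsMaximumIndepSet S) {F : Finset (Sym2 V)} (hF : IsEdgeMatching G F)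
    (hc : F.card = matchingNumber G) {v : V} (hv : v ∉ S) : ∃ w ∈ S, s(v, w) ∈ F := by
  classical
  have hcard : F.card = Sᶜ.card := by
    rw [card_compl, card_eq_indepNum hS, hc]
    unfold IsKonigEgervary at hG
    omega
  obtain ⟨w, hw, h⟩ := hF.exists_partner (W := Sᶜ)
    (fun e he => by simpa using exists_notMem_of_isIndepSet hS.isIndepSet (hF.1 e he)) hcard
    (mem_compl.2 hv)
  exact ⟨w, by simpa using hw, h⟩

theorem IsKonigEgervary.mem_of_notMem (hG : IsKonigEgervary G) {S : Finset V}
    (hS : G.IsMaximumIndepSet S) {F : Finset (Sym2 V)} (hF : IsEdgeMatching G F)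
    (hc : F.card = matchingNumber G) {v w : V} (hvw : s(v, w) ∈ F) (hv : v ∉ S) : w ∈ S := by
  obtain ⟨u, hu, h⟩ := hG.exists_partner hS hF hc hv
  have := hF.2 _ hvw _ h v (Sym2.mem_mk_left _ _) (Sym2.mem_mk_left _ _)
  rwa [Sym2.congr_right.1 this]

theorem difference_le_criticalDifference (X : Finset V) :
    difference G X ≤ criticalDifference G :=
  le_sup' (difference G) (mem_univ X)

theorem criticalDifference_le {c : ℤ} (h : ∀ X, difference G X ≤ c) :
    criticalDifference G ≤ c :=
  sup'_le _ _ fun X _ => h X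

theorem isCriticalIndepSet_of_le {X : Finset V} (hX : G.IsIndepSet (X : Set V))
    (h : criticalDifference G ≤ difference G X) : IsCriticalIndepSet G X :=
  ⟨hX, le_antisymm (difference_le_criticalDifference X) h⟩

/-- A maximum matching injects the complement of a maximum independent set `S` into `S` by `p`. It
sends `X \ S` into `N(X) ∩ S`. A vertex of `X ∩ S` either has its partner in `N(X) \ S` or is one of
the `|S| - |Sᶜ| = α - μ` vertices of `S` missed by `p`. -/
theorem IsKonigEgervary.difference_le (hG : IsKonigEgervary G) (X : Finset V) :
    difference G X ≤ (G.indepNum : ℤ) - matchingNumber G := by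
  classical
  obtain ⟨S, hS⟩ := SimpleGraph.maximumIndepSet_exists (G := G)
  obtain ⟨F, hF, hc⟩ := exists_isEdgeMatching_card_eq G
  have hp : ∀ v, v ∉ S → ∃ w ∈ S, s(v, w) ∈ F := fun v hv => hG.exists_partner hS hF hc hv
  choose! p hpS hpF using hp
  have hadj : ∀ v, v ∉ S → G.Adj v (p v) := fun v hv => hF.1 _ (hpF v hv)
  have hinj : Set.InjOn p (Sᶜ : Finset V) := by
    intro v hv w hw h
    have hv' := hpF v (by simpa using hv)
    have hw' := hpF w (by simpa using hw)
    rw [← h] at hw'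
    exact Sym2.congr_left.1
      (hF.2 _ hv' _ hw' (p v) (Sym2.mem_mk_right _ _) (Sym2.mem_mk_right _ _))
  set N := univ.filter fun v => v ∈ nbhd G (X : Set V) with hN
  have hNc : (nbhd G (X : Set V)).ncard = N.card := by
    rw [← Set.ncard_coe_finset]; congr 1; ext; simp [hN]
  have h1 : (X \ S).card ≤ (N ∩ S).card := by
    refine card_le_card_of_injOn p (fun v hv => ?_) (hinj.mono fun v hv => ?_)
    · have hv' := mem_sdiff.1 hv
      simp only [hN, coe_inter, coe_filter, Set.mem_inter_iff, Set.mem_ofPred_eq, mem_univ,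
        true_and]
      exact ⟨mem_nbhd.2 ⟨v, hv'.1, (hadj v hv'.2).symm⟩, hpS v hv'.2⟩
    · simpa using (mem_sdiff.1 hv).2
  have h2 : (X ∩ S).card ≤ (N \ S).card + (S \ Sᶜ.image p).card := by
    have : X ∩ S ⊆ (N \ S).image p ∪ (S \ Sᶜ.image p) := by
      intro x hx
      obtain ⟨hxX, hxS⟩ := mem_inter.1 hx
      by_cases h : x ∈ Sᶜ.image p
      · obtain ⟨v, hv, rfl⟩ := mem_image.1 h
        have hv' := mem_compl.1 hv
        refine mem_union_left _ (mem_image_of_mem _ (mem_sdiff.2 ⟨?_, hv'⟩))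
        simp only [hN, mem_filter, mem_univ, true_and]
        exact mem_nbhd.2 ⟨p v, hxX, hadj v hv'⟩
      · exact mem_union_right _ (mem_sdiff.2 ⟨hxS, h⟩)
    exact (card_le_card this).trans ((card_union_le _ _).trans
      (Nat.add_le_add_right card_image_le _))
  have h3 : (S \ Sᶜ.image p).card + Sᶜ.card = S.card := by
    rw [← card_image_of_injOn hinj]
    refine card_sdiff_add_card_eq_card (image_subset_iff.2 fun v hv => hpS v (mem_compl.1 hv))
  have h4 := card_sdiff_add_card_inter X S
  have h5 := card_sdiff_add_card_inter N S
  have h6 := card_add_card_compl S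
  have h7 := card_eq_indepNum hS
  unfold IsKonigEgervary at hG
  rw [difference, hNc]
  omega

/-- Since `N(S) ⊆ Sᶜ`, the difference of `S` is at least `α - (n - α) = α - μ`, the upper bound of
`difference_le`. -/
theorem IsKonigEgervary.isCriticalIndepSet (hG : IsKonigEgervary G) {S : Finset V}
    (hS : G.IsMaximumIndepSet S) : IsCriticalIndepSet G S := by
  classical
  refine isCriticalIndepSet_of_le hS.isIndepSet
    ((criticalDifference_le hG.difference_le).trans ?_)
  have hsub : nbhd G (S : Set V) ⊆ (Sᶜ : Finset V) := fun v hv => by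
    obtain ⟨w, hw, h⟩ := mem_nbhd.1 hv
    simp only [coe_compl, Set.mem_compl_iff]
    exact fun hvS => hS.isIndepSet hvS hw h.ne h
  have := Set.ncard_le_ncard hsub (Set.toFinite _)
  rw [Set.ncard_coe_finset] at this
  have h6 := card_add_card_compl S
  have h7 := card_eq_indepNum hS
  unfold IsKonigEgervary at hG
  rw [difference]
  omega

theorem IsKonigEgervary.ker_subset_core (hG : IsKonigEgervary G) : ker G ⊆ core G :=
  fun _ hv _ hS => hv _ (hG.isCriticalIndepSet hS)

theorem difference_add_le [DecidableEq V] (X Y : Finset V) :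
    difference G X + difference G Y ≤ difference G (X ∩ Y) + difference G (X ∪ Y) := by
  have h1 : nbhd G ((X ∩ Y : Finset V) : Set V) ⊆ nbhd G (X : Set V) ∩ nbhd G (Y : Set V) := by
    intro v hv
    obtain ⟨w, hw, h⟩ := mem_nbhd.1 hv
    rw [coe_inter] at hw
    exact ⟨mem_nbhd.2 ⟨w, hw.1, h⟩, mem_nbhd.2 ⟨w, hw.2, h⟩⟩
  have h2 : nbhd G ((X ∪ Y : Finset V) : Set V) ⊆ nbhd G (X : Set V) ∪ nbhd G (Y : Set V) := by
    intro v hv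
    obtain ⟨w, hw, h⟩ := mem_nbhd.1 hv
    rw [coe_union] at hw
    exact hw.imp (fun hw => mem_nbhd.2 ⟨w, hw, h⟩) (fun hw => mem_nbhd.2 ⟨w, hw, h⟩)
  have h3 := Set.ncard_le_ncard h1 (Set.toFinite _)
  have h4 := Set.ncard_le_ncard h2 (Set.toFinite _)
  have h5 := Set.ncard_union_add_ncard_inter (nbhd G (X : Set V)) (nbhd G (Y : Set V))
  have h6 := card_union_add_card_inter X Y
  simp only [difference]
  omega

/-- If there is a critical independent set, then `ker(G)` is the least one. -/
theorem exists_isCriticalIndepSet_eq_ker (h : ∃ A, IsCriticalIndepSet G A) :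
    ∃ K, IsCriticalIndepSet G K ∧ ker G = K := by
  classical
  obtain ⟨K, hK, hmin⟩ := exists_min_image (univ.filter fun A => IsCriticalIndepSet G A) card
    (h.imp fun A hA => by simpa using hA)
  simp only [mem_filter, mem_univ, true_and] at hK hmin
  refine ⟨K, hK, Set.Subset.antisymm (fun v hv => hv K hK) fun v hv A hA => ?_⟩
  -- The union has difference at most `d(G)`, so supermodularity forces the intersection to reach
  -- `d(G)`.
  have hcrit : IsCriticalIndepSet G (K ∩ A) := by
    refine isCriticalIndepSet_of_le (hK.1.mono (by simp)) ?_
    have h1 := difference_add_le (G := G) K A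
    have h2 := difference_le_criticalDifference (G := G) (K ∪ A)
    rw [hK.2, hA.2] at h1
    linarith
  have := eq_of_subset_of_card_le inter_subset_left (hmin _ hcrit)
  rw [mem_coe, ← this] at hv
  exact (mem_inter.1 hv).2

end Fintype

end KonigEgervary

/-! ### Hall's theorem applied to critical edges and edge deletion. -/

namespace KonigEgervary

open Finset

variable {V : Type*}

/-- Hall's theorem for a relation between two finite sets. -/
theorem exists_injOn_of_card_le [DecidableEq V] (r : V → V → Prop) [DecidableRel r]
    (X Y : Finset V)
    (h : ∀ A ⊆ Y, A.card ≤ (X.filter fun x => ∃ y ∈ A, r y x).card) :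
    ∃ f : V → V, Set.InjOn f Y ∧ ∀ y ∈ Y, f y ∈ X ∧ r y (f y) := by
  obtain ⟨f, hf, hfr⟩ := (all_card_le_biUnion_card_iff_exists_injective
    fun y : Y => X.filter fun x => r y x).1 fun A => by
      have hA := h (A.map (Function.Embedding.subtype _)) fun v hv => by
        obtain ⟨w, -, rfl⟩ := mem_map.1 hv
        exact w.2
      rw [card_map] at hA
      refine hA.trans (card_le_card fun x hx => ?_)
      obtain ⟨hxX, y, hy, hr⟩ := mem_filter.1 hx
      obtain ⟨w, hw, rfl⟩ := mem_map.1 hy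
      exact mem_biUnion.2 ⟨w, hw, mem_filter.2 ⟨hxX, hr⟩⟩
  refine ⟨fun v => if hv : v ∈ Y then f ⟨v, hv⟩ else v, fun v hv w hw hvw => ?_, fun y hy => ?_⟩
  · simp only [mem_coe] at hv hw
    simp only [hv, hw, dif_pos] at hvw
    exact congrArg Subtype.val (hf hvw)
  · simpa only [hy, dif_pos] using mem_filter.1 (hfr ⟨y, hy⟩)

variable [Fintype V] {G : SimpleGraph V}

/-- The neighborhood of the least critical independent set `K` is matched into `K` minus any
given vertex. -/
theorem IsCriticalIndepSet.exists_injOn_nbhd [DecidableEq V] {K N : Finset V}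
    (hK : IsCriticalIndepSet G K) (hmin : ∀ A, IsCriticalIndepSet G A → K ⊆ A)
    (hN : (N : Set V) = nbhd G (K : Set V)) (a : V) :
    ∃ f : V → V, Set.InjOn f N ∧ ∀ y ∈ N, f y ∈ K.erase a ∧ G.Adj y (f y) := by
  classical
  refine exists_injOn_of_card_le G.Adj (K.erase a) N fun A hA => ?_
  by_contra! hlt
  have hne : A.Nonempty := card_pos.1 (by omega)
  set K' := K.filter fun x => ¬ ∃ y ∈ A, G.Adj y x with hK'
  -- Putting `a` back adds at most one vertex, which the strict Hall violation absorbs.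
  have h1 : (K.filter fun x => ∃ y ∈ A, G.Adj y x).card ≤ A.card := by
    have := pred_card_le_card_erase (s := K.filter fun x => ∃ y ∈ A, G.Adj y x) (a := a)
    rw [← filter_erase] at this
    omega
  have h2 : (K.filter fun x => ∃ y ∈ A, G.Adj y x).card + K'.card = K.card :=
    card_filter_add_card_filter_not _
  have hsub : nbhd G (K' : Set V) ⊆ (N \ A : Finset V) := by
    intro v hv
    obtain ⟨w, hw, h⟩ := mem_nbhd.1 hv
    obtain ⟨hwK, hwA⟩ := mem_filter.1 (mem_coe.1 hw)
    rw [coe_sdiff, hN]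
    exact ⟨mem_nbhd.2 ⟨w, hwK, h⟩, fun hvA => hwA ⟨v, hvA, h⟩⟩
  have h3 := Set.ncard_le_ncard hsub (Set.toFinite _)
  rw [Set.ncard_coe_finset] at h3
  have h4 := card_sdiff_add_card_eq_card hA
  -- Passing from `K` to `K'` loses at most `|A|` vertices and at least `|A|` neighbors. As `A` is
  -- nonempty, this contradicts the minimality of `K`.
  have hcrit : IsCriticalIndepSet G K' := by
    refine isCriticalIndepSet_of_le (hK.1.mono (coe_subset.2 (filter_subset _ _))) ?_
    rw [← hK.2, difference, difference, ← hN, Set.ncard_coe_finset]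
    omega
  obtain ⟨y, hy⟩ := hne
  have hyN : y ∈ nbhd G (K : Set V) := hN ▸ mem_coe.2 (hA hy)
  obtain ⟨w, hw, h⟩ := mem_nbhd.1 hyN
  exact (mem_filter.1 (hmin _ hcrit hw)).2 ⟨y, hy, h⟩

/-- No `μ`-critical edge has an end in `N(ker(G))`. -/
theorem not_isMuCritical_of_mem_nbhd_ker (hex : ∃ A, IsCriticalIndepSet G A) {a b : V}
    (hb : b ∈ nbhd G (ker G)) : ¬ IsMuCritical G s(a, b) := by
  classical
  intro hcrit
  obtain ⟨K, hK, hker⟩ := exists_isCriticalIndepSet_eq_ker hex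
  have hmin : ∀ A, IsCriticalIndepSet G A → K ⊆ A := fun A hA v hv =>
    (hker ▸ mem_coe.2 hv : v ∈ ker G) A hA
  obtain ⟨N, hN⟩ : ∃ N : Finset V, (N : Set V) = nbhd G (K : Set V) :=
    ⟨(Set.toFinite (nbhd G (K : Set V))).toFinset, Set.Finite.coe_toFinset _⟩
  have hmemN : ∀ v, v ∈ N ↔ ∃ w ∈ K, G.Adj v w := fun v => by
    rw [← mem_coe, hN, mem_nbhd]; rfl
  rw [hker, mem_nbhd] at hb
  have hbN : b ∈ N := (hmemN b).2 hb
  have hdisj : Disjoint K N := disjoint_left.2 fun v hv hvN => by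
    obtain ⟨w, hw, h⟩ := (hmemN v).1 hvN
    exact hK.1 hv hw h.ne h
  obtain ⟨f, hinj, hf⟩ := hK.exists_injOn_nbhd hmin hN a
  obtain ⟨F, hF, hc⟩ := exists_isEdgeMatching_card_eq G
  have hle := hF.card_le_of_exchange (G' := G.deleteEdges {s(a, b)})
    (hdisj.mono_left (erase_subset a K)) (fun e he x hx hxe => by
      obtain ⟨w, rfl⟩ := Sym2.mem_iff_exists.1 hxe
      have hxw : G.Adj x w := hF.1 _ he
      exact ⟨w, (hmemN w).2 ⟨x, mem_of_mem_erase hx, hxw.symm⟩, Sym2.mem_mk_right _ _⟩)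
    (fun e he hno => by
      rw [SimpleGraph.edgeSet_deleteEdges]
      refine ⟨hF.1 e he, fun h => ?_⟩
      rw [Set.mem_singleton_iff] at h
      exact hno b hbN (h ▸ Sym2.mem_mk_right _ _))
    f (fun y hy => (hf y hy).1) hinj (fun y hy => by
      rw [SimpleGraph.deleteEdges_adj]
      refine ⟨(hf y hy).2, fun h => ?_⟩
      obtain ⟨hfa, hfK⟩ := mem_erase.1 (hf y hy).1
      rcases Sym2.eq_iff.1 h with ⟨-, h⟩ | ⟨-, h⟩
      · exact disjoint_left.1 hdisj hfK (h ▸ hbN)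
      · exact hfa h)
  exact absurd hcrit.2 (not_lt.2 (hc ▸ hle))

theorem IsKonigEgervary.exists_isCriticalIndepSet (hG : IsKonigEgervary G) :
    ∃ A, IsCriticalIndepSet G A :=
  (SimpleGraph.maximumIndepSet_exists (G := G)).imp fun _ hS => hG.isCriticalIndepSet hS

theorem mem_edgesBetween_of_isMuCritical (hex : ∃ A, IsCriticalIndepSet G A) {e : Sym2 V}
    (he : e ∈ edgesBetween G (core G) (nbhd G (core G))) (hcrit : IsMuCritical G e) :
    e ∈ edgesBetween G (core G \ ker G) (nbhd G (core G) \ nbhd G (ker G)) := by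
  obtain ⟨hE, a, ha, b, hb, rfl⟩ := he
  have hbN : b ∉ nbhd G (ker G) := fun h => not_isMuCritical_of_mem_nbhd_ker hex h hcrit
  have hba : G.Adj b a := SimpleGraph.Adj.symm hE
  exact ⟨hE, a, ⟨ha, fun hak => hbN (mem_nbhd.2 ⟨a, hak, hba⟩)⟩, b, ⟨hb, hbN⟩, rfl⟩

theorem IsKonigEgervary.numCoreMuCritical_add_eps_le (hG : IsKonigEgervary G) :
    numCoreMuCritical G + eps G ≤ xi G := by
  classical
  obtain ⟨F, hF, hc⟩ := exists_isEdgeMatching_card_eq G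
  set C : Set (Sym2 V) :=
    {e | e ∈ edgesBetween G (core G) (nbhd G (core G)) ∧ IsMuCritical G e} with hC
  have hCfin : C.Finite := Set.toFinite _
  have hWfin : (core G \ ker G).Finite := Set.toFinite _
  have hCF : ∀ e ∈ hCfin.toFinset, e ∈ F := fun e he =>
    ((hCfin.mem_toFinset.1 he).2).mem hF hc
  have hle := IsEdgeMatching.card_le_of_cover (G := G) (F := hCfin.toFinset)
    (W := hWfin.toFinset)
    ⟨fun e he => hF.1 e (hCF e he), fun e he f hf => hF.2 e (hCF e he) f (hCF f hf)⟩
    fun e he => by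
      obtain ⟨h1, h2⟩ := hCfin.mem_toFinset.1 he
      obtain ⟨-, a, ha, b, -, rfl⟩ :=
        mem_edgesBetween_of_isMuCritical hG.exists_isCriticalIndepSet h1 h2
      exact ⟨a, hWfin.mem_toFinset.2 ha, Sym2.mem_mk_left _ _⟩
  rw [← Set.ncard_eq_toFinset_card, ← Set.ncard_eq_toFinset_card] at hle
  have := Set.ncard_sdiff_add_ncard_of_subset hG.ker_subset_core (Set.toFinite _)
  unfold numCoreMuCritical eps xi
  rw [← hC]
  omega

theorem indepNum_le_deleteEdges (G : SimpleGraph V) (s : Set (Sym2 V)) :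
    G.indepNum ≤ (G.deleteEdges s).indepNum := by
  obtain ⟨S, hS⟩ := G.exists_isNIndepSet_indepNum
  rw [← hS.card_eq]
  refine SimpleGraph.IsIndepSet.card_le_indepNum fun v hv w hw hne h => ?_
  exact hS.isIndepSet hv hw hne (SimpleGraph.deleteEdges_le s h)

/-- Deletion cannot lower `α`, and here it does not lower `μ`, while `α + μ ≤ n` in every graph. -/
theorem IsKonigEgervary.deleteEdges_of_not_isMuCritical (hG : IsKonigEgervary G) {e : Sym2 V}
    (he : e ∈ G.edgeSet) (hcrit : ¬ IsMuCritical G e) :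
    IsKonigEgervary (G.deleteEdges {e}) := by
  have h1 : matchingNumber G ≤ matchingNumber (G.deleteEdges {e}) :=
    not_lt.1 fun h => hcrit ⟨he, h⟩
  have h2 := indepNum_le_deleteEdges G {e}
  have h3 := indepNum_add_matchingNumber_le (G.deleteEdges {e})
  unfold IsKonigEgervary at *
  omega

/-- The deletion of an edge both of whose ends lie in maximum independent sets leaves a
König–Egerváry graph. -/
theorem IsKonigEgervary.deleteEdges_of_mem (hG : IsKonigEgervary G) {a b : V}
    (hab : G.Adj a b) {S T : Finset V} (hS : G.IsMaximumIndepSet S)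
    (hT : G.IsMaximumIndepSet T) (haS : a ∈ S) (hbT : b ∈ T) :
    IsKonigEgervary (G.deleteEdges {s(a, b)}) := by
  classical
  by_cases hcrit : IsMuCritical G s(a, b)
  swap
  · exact hG.deleteEdges_of_not_isMuCritical hab hcrit
  obtain ⟨F, hF, hc⟩ := exists_isEdgeMatching_card_eq G
  set G' := G.deleteEdges {s(a, b)} with hG'
  have hG'G : G' ≤ G := SimpleGraph.deleteEdges_le _
  have hbS : b ∉ S := fun hbS => hS.isIndepSet haS hbS hab.ne hab
  have hbY : b ∈ T \ S := mem_sdiff.2 ⟨hbT, hbS⟩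
  -- Such an injection could be exchanged for the edges of `F` meeting `T \ S`, among them any edge
  -- at `b`, giving a matching of `G'` as large as `F`.
  have hnot : ¬ ∃ f : V → V, Set.InjOn f (T \ S : Finset V) ∧
      ∀ y ∈ T \ S, f y ∈ S \ T ∧ G'.Adj y (f y) := by
    rintro ⟨f, hinj, hf⟩
    have hle := hF.card_le_of_exchange (G' := G') (X := S \ T) (Y := T \ S)
      (disjoint_left.2 fun v hv hv' => (mem_sdiff.1 hv).2 (mem_sdiff.1 hv').1)
      (fun e he x hx hxe => by
        obtain ⟨w, rfl⟩ := Sym2.mem_iff_exists.1 hxe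
        obtain ⟨hxS, hxT⟩ := mem_sdiff.1 hx
        have hxw : G.Adj x w := hF.1 _ he
        exact ⟨w, mem_sdiff.2 ⟨hG.mem_of_notMem hT hF hc he hxT,
          fun hwS => hS.isIndepSet hxS hwS hxw.ne hxw⟩, Sym2.mem_mk_right _ _⟩)
      (fun e he hno => by
        rw [hG', SimpleGraph.edgeSet_deleteEdges]
        refine ⟨hF.1 e he, fun h => ?_⟩
        rw [Set.mem_singleton_iff] at h
        exact hno b hbY (h ▸ Sym2.mem_mk_right _ _))
      f (fun y hy => (hf y hy).1) hinj (fun y hy => (hf y hy).2)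
    exact absurd hcrit.2 (not_lt.2 (hc ▸ hle))
  have hHall := mt (exists_injOn_of_card_le G'.Adj (S \ T) (T \ S)) hnot
  push Not at hHall
  obtain ⟨A, hA, hlt⟩ := hHall
  -- For the Hall violator `A`, replacing `B` by `A` in `S` yields a larger independent set of `G'`.
  -- Thus `α` gains at least one, which offsets the loss of at most one in `μ`.
  set B := (S \ T).filter fun x => ∃ y ∈ A, G'.Adj y x with hB
  have hAT : ∀ v ∈ A, v ∈ T ∧ v ∉ S := fun v hv => mem_sdiff.1 (hA hv)
  have hAS : ∀ v ∈ A, ∀ w ∈ S \ B, ¬ G'.Adj v w := by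
    intro v hv w hw h
    obtain ⟨hwS, hwB⟩ := mem_sdiff.1 hw
    refine hwB (mem_filter.2 ⟨mem_sdiff.2 ⟨hwS, fun hwT => ?_⟩, v, hv, h⟩)
    exact hT.isIndepSet (hAT v hv).1 hwT h.ne (hG'G h)
  have hind : G'.IsIndepSet ((S \ B ∪ A : Finset V) : Set V) := by
    intro v hv w hw hne h
    rcases mem_union.1 (mem_coe.1 hv) with hv | hv <;>
      rcases mem_union.1 (mem_coe.1 hw) with hw | hw
    · exact hS.isIndepSet (mem_sdiff.1 hv).1 (mem_sdiff.1 hw).1 hne (hG'G h)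
    · exact hAS w hw v hv h.symm
    · exact hAS v hv w hw h
    · exact hT.isIndepSet (hAT v hv).1 (hAT w hw).1 hne (hG'G h)
  have h1 := hind.card_le_indepNum
  rw [card_union_of_disjoint (disjoint_left.2 fun v hv hv' =>
    (hAT v hv').2 (mem_sdiff.1 hv).1)] at h1
  have h2 : (S \ B).card + B.card = S.card :=
    card_sdiff_add_card_eq_card fun v hv => (mem_sdiff.1 (mem_filter.1 hv).1).1
  have h3 := card_eq_indepNum hS
  have h4 := indepNum_add_matchingNumber_le G'
  have h5 : matchingNumber G ≤ matchingNumber G' + 1 := by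
    have := IsEdgeMatching.card_le_matchingNumber (G := G') (F := F.erase s(a, b))
      ⟨fun e he => by
        rw [hG', SimpleGraph.edgeSet_deleteEdges]
        exact ⟨hF.1 e (mem_of_mem_erase he), (mem_erase.1 he).1⟩,
        fun e he f hf => hF.2 e (mem_of_mem_erase he) f (mem_of_mem_erase hf)⟩
    have := pred_card_le_card_erase (s := F) (a := s(a, b))
    omega
  unfold IsKonigEgervary at *
  omega

theorem IsKonigEgervary.numEdges_le_rhoE_add (hG : IsKonigEgervary G) :
    numEdges G ≤ rhoE G + numCoreMuCritical G := by
  refine (Set.ncard_le_ncard (fun e he => ?_) (Set.toFinite _)).trans (Set.ncard_union_le _ _)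
  by_cases hKE : IsKonigEgervary (G.deleteEdges {e})
  · exact Or.inl ⟨he, hKE⟩
  have hcrit : IsMuCritical G e := by
    by_contra h
    exact hKE (hG.deleteEdges_of_not_isMuCritical he h)
  refine Or.inr ⟨⟨he, ?_⟩, hcrit⟩
  obtain ⟨F, hF, hc⟩ := exists_isEdgeMatching_card_eq G
  have heF := hcrit.mem hF hc
  induction e with
  | _ a b =>
    have hab : G.Adj a b := he
    by_cases ha : a ∈ core G
    · exact ⟨a, ha, b, mem_nbhd.2 ⟨a, ha, hab.symm⟩, rfl⟩
    by_cases hb : b ∈ core G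
    · exact ⟨b, hb, a, mem_nbhd.2 ⟨b, hb, hab⟩, Sym2.eq_swap⟩
    have hS : ∃ S, G.IsMaximumIndepSet S ∧ a ∉ S := by
      by_contra! h
      exact ha h
    have hT : ∃ T, G.IsMaximumIndepSet T ∧ b ∉ T := by
      by_contra! h
      exact hb h
    obtain ⟨S, hS, haS⟩ := hS
    obtain ⟨T, hT, hbT⟩ := hT
    -- The edge `ab` is in `F`, so `T`, which misses `b`, contains `a`, and `S`, which misses `a`,
    -- contains `b`.
    exact absurd (hG.deleteEdges_of_mem hab hT hS
      (hG.mem_of_notMem hT hF hc (Sym2.eq_swap ▸ heF) hbT)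
      (hG.mem_of_notMem hS hF hc heF haS)) hKE

end KonigEgervary

/-! ### The extremal graphs: disjoint paws and isolated vertices. -/

namespace KonigEgervary

open Finset

/-- The graph transported along `φ` from the disjoint union of `j` copies of the paw (`Fin 4`, two
distinct vertices being adjacent if their sum is at least `3`) and `k` isolated vertices. -/
def pawGraph {V : Type*} {j k : ℕ} (φ : V ≃ (Fin j × Fin 4) ⊕ Fin k) : SimpleGraph V where
  -- Each copy is the triangle 1, 2, 3 with the pendant vertex 0 attached to 3.
  Adj v w := ∃ i a b, φ v = Sum.inl (i, a) ∧ φ w = Sum.inl (i, b) ∧ a ≠ b ∧ 3 ≤ a.val + b.val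
  symm := ⟨fun _ _ ⟨i, a, b, hv, hw, hne, hab⟩ => ⟨i, b, a, hw, hv, hne.symm, by omega⟩⟩
  loopless := ⟨fun _ ⟨_, _, _, hv, hw, hne, _⟩ => hne (by simpa [hv] using hw)⟩

namespace pawGraph

variable {V : Type*} {j k : ℕ} {φ : V ≃ (Fin j × Fin 4) ⊕ Fin k}

theorem adj_symm_inl {i i' : Fin j} {a b : Fin 4} :
    (pawGraph φ).Adj (φ.symm (Sum.inl (i, a))) (φ.symm (Sum.inl (i', b))) ↔
      i = i' ∧ a ≠ b ∧ 3 ≤ a.val + b.val := by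
  simp only [pawGraph, Equiv.apply_symm_apply, Sum.inl.injEq, Prod.mk.injEq]
  constructor
  · rintro ⟨_, _, _, ⟨rfl, rfl⟩, ⟨rfl, rfl⟩, h⟩
    exact ⟨rfl, h⟩
  · rintro ⟨rfl, h⟩
    exact ⟨_, _, _, ⟨rfl, rfl⟩, ⟨rfl, rfl⟩, h⟩

theorem not_adj_symm_inr (i : Fin k) (v : V) : ¬ (pawGraph φ).Adj (φ.symm (Sum.inr i)) v := by
  rintro ⟨_, _, _, h, -⟩
  simp at h

/-- The vertices of the paws with labels in `A`, and those of the isolated vertices in `B`. -/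
def labelled (φ : V ≃ (Fin j × Fin 4) ⊕ Fin k) (A : Finset (Fin 4)) (B : Finset (Fin k)) :
    Finset V :=
  (((univ : Finset (Fin j)) ×ˢ A).disjSum B).map φ.symm.toEmbedding

theorem card_labelled (A : Finset (Fin 4)) (B : Finset (Fin k)) :
    (labelled φ A B).card = j * A.card + B.card := by
  simp [labelled]

theorem symm_inl_mem_labelled {A : Finset (Fin 4)} {B : Finset (Fin k)} {i : Fin j} {a : Fin 4} :
    φ.symm (Sum.inl (i, a)) ∈ labelled φ A B ↔ a ∈ A := by
  simp [labelled]

theorem symm_inr_mem_labelled {A : Finset (Fin 4)} {B : Finset (Fin k)} {i : Fin k} :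
    φ.symm (Sum.inr i) ∈ labelled φ A B ↔ i ∈ B := by
  simp [labelled]

theorem cases_symm {P : V → Prop} (hl : ∀ i a, P (φ.symm (Sum.inl (i, a))))
    (hr : ∀ i, P (φ.symm (Sum.inr i))) (v : V) : P v := by
  rw [← φ.symm_apply_apply v]
  rcases φ v with ⟨i, a⟩ | i
  · exact hl i a
  · exact hr i

theorem isIndepSet_labelled {A : Finset (Fin 4)} {B : Finset (Fin k)}
    (hA : ∀ a ∈ A, ∀ b ∈ A, a ≠ b → a.val + b.val < 3) :
    (pawGraph φ).IsIndepSet (labelled φ A B : Set V) := by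
  intro v hv w hw _ h
  rw [mem_coe] at hv hw
  induction v using cases_symm (φ := φ) with
  | hr i => exact not_adj_symm_inr _ _ h
  | hl i a =>
    induction w using cases_symm (φ := φ) with
    | hr i => exact not_adj_symm_inr _ _ h.symm
    | hl i' b =>
      obtain ⟨-, hne, hab⟩ := adj_symm_inl.1 h
      have := hA a (symm_inl_mem_labelled.1 hv) b (symm_inl_mem_labelled.1 hw) hne
      omega

theorem isIndepSet_labelled_pair (φ : V ≃ (Fin j × Fin 4) ⊕ Fin k) {b : Fin 4}
    (hb : b = 1 ∨ b = 2) : (pawGraph φ).IsIndepSet (labelled φ {0, b} univ : Set V) :=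
  isIndepSet_labelled (by rcases hb with rfl | rfl <;> decide)

theorem card_labelled_pair (φ : V ≃ (Fin j × Fin 4) ⊕ Fin k) {b : Fin 4}
    (hb : b = 1 ∨ b = 2) : (labelled φ {0, b} univ).card = j * 2 + k := by
  rw [card_labelled, card_pair (by rcases hb with rfl | rfl <;> decide)]
  simp

theorem nbhd_insert_symm_inr [DecidableEq V] (A : Finset V) (i : Fin k) :
    nbhd (pawGraph φ) (insert (φ.symm (Sum.inr i)) A : Finset V) = nbhd (pawGraph φ) A := by
  ext v
  simp only [mem_nbhd, coe_insert, Set.mem_insert_iff, exists_eq_or_imp, mem_coe]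
  exact or_iff_right fun h => not_adj_symm_inr i v h.symm

theorem adj_iff_of_symm_inl {i : Fin j} {a : Fin 4} {v : V} :
    (pawGraph φ).Adj (φ.symm (Sum.inl (i, a))) v ↔
      ∃ b, v = φ.symm (Sum.inl (i, b)) ∧ a ≠ b ∧ 3 ≤ a.val + b.val := by
  induction v using cases_symm (φ := φ) with
  | hr i' => simpa using fun h => not_adj_symm_inr i' _ h.symm
  | hl i' b =>
    rw [adj_symm_inl]
    constructor
    · rintro ⟨rfl, h⟩
      exact ⟨b, rfl, h⟩
    · rintro ⟨c, hc, h⟩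
      simp only [EmbeddingLike.apply_eq_iff_eq, Sum.inl.injEq, Prod.mk.injEq] at hc
      obtain ⟨rfl, rfl⟩ := hc
      exact ⟨rfl, h⟩

variable [Fintype V]

theorem card_eq (φ : V ≃ (Fin j × Fin 4) ⊕ Fin k) : Fintype.card V = j * 4 + k := by
  rw [Fintype.card_congr φ]
  simp

theorem le_matchingNumber (φ : V ≃ (Fin j × Fin 4) ⊕ Fin k) :
    j * 2 ≤ matchingNumber (pawGraph φ) := by
  classical
  -- `Fin.rev` sends 1 to 2 and 3 to 0, giving the perfect matching {12, 03} of each paw.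
  let f : V → V := fun v => φ.symm ((φ v).map (fun p => (p.1, Fin.rev p.2)) id)
  have hinj : Function.Injective f := by
    refine φ.symm.injective.comp (Function.Injective.comp ?_ φ.injective)
    refine Sum.map_injective.2 ⟨fun p q h => ?_, Function.injective_id⟩
    exact Prod.ext (Prod.ext_iff.1 h).1 (Fin.rev_injective (Prod.ext_iff.1 h).2)
  have h : ∀ y ∈ labelled φ {1, 3} ∅, f y ∉ labelled φ {1, 3} ∅ ∧ (pawGraph φ).Adj y (f y) := by
    intro y hy
    induction y using cases_symm (φ := φ) with
    | hr i => simp [symm_inr_mem_labelled] at hy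
    | hl i a =>
      have hf : f (φ.symm (Sum.inl (i, a))) = φ.symm (Sum.inl (i, Fin.rev a)) := by simp [f]
      have ha := symm_inl_mem_labelled.1 hy
      rw [hf, symm_inl_mem_labelled, adj_symm_inl]
      have key : ∀ a ∈ ({1, 3} : Finset (Fin 4)), Fin.rev a ∉ ({1, 3} : Finset (Fin 4)) ∧
        a ≠ Fin.rev a ∧ 3 ≤ a.val + (Fin.rev a).val := by decide
      exact ⟨(key a ha).1, rfl, (key a ha).2⟩
  obtain ⟨hF, hc⟩ := isEdgeMatching_image (fun y hy => (h y hy).1) hinj.injOn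
    fun y hy => (h y hy).2
  have := hF.card_le_matchingNumber
  rw [hc, card_labelled] at this
  simpa using this

/-- The two lower bounds already add up to the number of vertices, so both are equalities. -/
theorem indepNum_eq_and_matchingNumber_eq (φ : V ≃ (Fin j × Fin 4) ⊕ Fin k) :
    (pawGraph φ).indepNum = j * 2 + k ∧ matchingNumber (pawGraph φ) = j * 2 := by
  have h1 := (isIndepSet_labelled_pair φ (Or.inl rfl)).card_le_indepNum
  rw [card_labelled_pair φ (Or.inl rfl)] at h1
  have h2 := le_matchingNumber φ
  have h3 := indepNum_add_matchingNumber_le (pawGraph φ)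
  rw [card_eq φ] at h3
  omega

theorem isKonigEgervary (φ : V ≃ (Fin j × Fin 4) ⊕ Fin k) : IsKonigEgervary (pawGraph φ) := by
  obtain ⟨h1, h2⟩ := indepNum_eq_and_matchingNumber_eq φ
  rw [IsKonigEgervary, h1, h2, card_eq φ]
  omega

theorem isMaximumIndepSet_labelled_pair (φ : V ≃ (Fin j × Fin 4) ⊕ Fin k) {b : Fin 4}
    (hb : b = 1 ∨ b = 2) : (pawGraph φ).IsMaximumIndepSet (labelled φ {0, b} univ) :=
  isMaximumIndepSet_of_card_eq (isIndepSet_labelled_pair φ hb)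
    (by rw [card_labelled_pair φ hb, (indepNum_eq_and_matchingNumber_eq φ).1])

/-- Adding a missing isolated vertex would raise the difference of a critical set by one. -/
theorem symm_inr_mem_ker (i : Fin k) : φ.symm (Sum.inr i) ∈ ker (pawGraph φ) := by
  classical
  intro A hA
  by_contra hi
  have h := difference_le_criticalDifference (G := pawGraph φ) (insert (φ.symm (Sum.inr i)) A)
  rw [← hA.2, difference, difference, nbhd_insert_symm_inr, card_insert_of_notMem hi] at h
  push_cast at h
  linarith

/-- If `S` missed 0, its partner 3 would lie in `S`, excluding 1 and 2. Then 1 would also need 3 as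
its partner. -/
theorem symm_inl_zero_mem_core (i : Fin j) : φ.symm (Sum.inl (i, 0)) ∈ core (pawGraph φ) := by
  intro S hS
  by_contra h0
  obtain ⟨F, hF, hc⟩ := exists_isEdgeMatching_card_eq (pawGraph φ)
  obtain ⟨w, hw, h0w⟩ := (isKonigEgervary φ).exists_partner hS hF hc h0
  obtain ⟨b, rfl, -, hb⟩ := adj_iff_of_symm_inl.1 (hF.1 _ h0w)
  obtain rfl : b = 3 := (by decide : ∀ b : Fin 4, 3 ≤ (0 : Fin 4).val + b.val → b = 3) b hb
  have hnot : ∀ a : Fin 4, a = 1 ∨ a = 2 → φ.symm (Sum.inl (i, a)) ∉ S := fun a ha haS => by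
    have : (pawGraph φ).Adj (φ.symm (Sum.inl (i, a))) (φ.symm (Sum.inl (i, 3))) :=
      adj_symm_inl.2 ⟨rfl, by rcases ha with rfl | rfl <;> decide⟩
    exact hS.isIndepSet haS hw this.ne this
  obtain ⟨u, hu, h1u⟩ := (isKonigEgervary φ).exists_partner hS hF hc (hnot 1 (Or.inl rfl))
  obtain ⟨b, rfl, hb1, hb⟩ := adj_iff_of_symm_inl.1 (hF.1 _ h1u)
  have hb2 : b ≠ 2 := fun h => hnot b (Or.inr h) hu
  obtain rfl : b = 3 :=
    (by decide : ∀ b : Fin 4, 1 ≠ b → b ≠ 2 → 3 ≤ (1 : Fin 4).val + b.val → b = 3) b hb1 hb2 hb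
  have := hF.2 _ h0w _ h1u _ (Sym2.mem_mk_right _ _) (Sym2.mem_mk_right _ _)
  simp at this

theorem core_eq (φ : V ≃ (Fin j × Fin 4) ⊕ Fin k) :
    core (pawGraph φ) = labelled φ {0} univ := by
  ext v
  rw [mem_coe]
  induction v using cases_symm (φ := φ) with
  | hr i =>
    rw [symm_inr_mem_labelled]
    exact iff_of_true ((isKonigEgervary φ).ker_subset_core (symm_inr_mem_ker i)) (mem_univ i)
  | hl i a =>
    rw [symm_inl_mem_labelled, mem_singleton]
    constructor
    · intro h
      have h1 := symm_inl_mem_labelled.1 (h _ (isMaximumIndepSet_labelled_pair φ (Or.inl rfl)))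
      have h2 := symm_inl_mem_labelled.1 (h _ (isMaximumIndepSet_labelled_pair φ (Or.inr rfl)))
      clear h
      decide +revert
    · rintro rfl
      exact symm_inl_zero_mem_core i

theorem ker_eq (φ : V ≃ (Fin j × Fin 4) ⊕ Fin k) :
    ker (pawGraph φ) = labelled φ ∅ univ := by
  have hcrit : IsCriticalIndepSet (pawGraph φ) (labelled φ ∅ univ) := by
    refine isCriticalIndepSet_of_le (isIndepSet_labelled (by simp))
      ((criticalDifference_le (isKonigEgervary φ).difference_le).trans ?_)
    obtain ⟨h1, h2⟩ := indepNum_eq_and_matchingNumber_eq φ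
    have hN : nbhd (pawGraph φ) (labelled φ ∅ univ : Set V) = ∅ := by
      refine Set.eq_empty_of_forall_notMem fun v hv => ?_
      obtain ⟨w, hw, h⟩ := mem_nbhd.1 hv
      rw [mem_coe] at hw
      induction w using cases_symm (φ := φ) with
      | hr i => exact not_adj_symm_inr _ _ h.symm
      | hl i a => simp [symm_inl_mem_labelled] at hw
    rw [difference, hN, card_labelled, h1, h2]
    simp
  refine Set.Subset.antisymm (fun v hv => hv _ hcrit) fun v hv => ?_
  rw [mem_coe] at hv
  induction v using cases_symm (φ := φ) with
  | hr i => exact symm_inr_mem_ker i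
  | hl i a => simp [symm_inl_mem_labelled] at hv

/-- The maximum independent sets labelled {0, 1} and {0, 2} both miss 3, so a maximum matching
without the edge 03 would match 3 to both 1 and 2. -/
theorem isMuCritical (i : Fin j) :
    IsMuCritical (pawGraph φ) s(φ.symm (Sum.inl (i, 0)), φ.symm (Sum.inl (i, 3))) := by
  have hadj : (pawGraph φ).Adj (φ.symm (Sum.inl (i, 0))) (φ.symm (Sum.inl (i, 3))) :=
    adj_symm_inl.2 ⟨rfl, by decide⟩
  refine ⟨hadj, lt_of_not_ge fun hle => ?_⟩
  have hle' := matchingNumber_mono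
    (SimpleGraph.deleteEdges_le (G := pawGraph φ)
      {s(φ.symm (Sum.inl (i, 0)), φ.symm (Sum.inl (i, 3)))})
  obtain ⟨F, hF', hc'⟩ := exists_isEdgeMatching_card_eq ((pawGraph φ).deleteEdges
    {s(φ.symm (Sum.inl (i, 0)), φ.symm (Sum.inl (i, 3)))})
  have hF := hF'.mono (SimpleGraph.deleteEdges_le _)
  have hc := hc'.trans (le_antisymm hle' hle)
  have key : ∀ b : Fin 4, b = 1 ∨ b = 2 →
      s(φ.symm (Sum.inl (i, 3)), φ.symm (Sum.inl (i, b))) ∈ F := by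
    intro b hb
    obtain ⟨w, hw, h⟩ := (isKonigEgervary φ).exists_partner
      (isMaximumIndepSet_labelled_pair φ hb) hF hc (v := φ.symm (Sum.inl (i, 3)))
      (by rw [symm_inl_mem_labelled]; rcases hb with rfl | rfl <;> decide)
    obtain ⟨c, rfl, -⟩ := adj_iff_of_symm_inl.1 (hF.1 _ h)
    rw [symm_inl_mem_labelled, mem_insert, mem_singleton] at hw
    rcases hw with rfl | rfl
    · have := hF'.1 _ h
      rw [SimpleGraph.edgeSet_deleteEdges] at this
      exact absurd Sym2.eq_swap this.2
    · exact h
  have := hF.2 _ (key 1 (Or.inl rfl)) _ (key 2 (Or.inr rfl)) _ (Sym2.mem_mk_left _ _)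
    (Sym2.mem_mk_left _ _)
  simp at this

theorem xi_eq (φ : V ≃ (Fin j × Fin 4) ⊕ Fin k) : xi (pawGraph φ) = j + k := by
  rw [xi, core_eq, Set.ncard_coe_finset, card_labelled]
  simp

theorem eps_eq (φ : V ≃ (Fin j × Fin 4) ⊕ Fin k) : eps (pawGraph φ) = k := by
  rw [eps, ker_eq, Set.ncard_coe_finset, card_labelled]
  simp

theorem numCoreMuCritical_eq (φ : V ≃ (Fin j × Fin 4) ⊕ Fin k) :
    numCoreMuCritical (pawGraph φ) = j := by
  refine le_antisymm ?_ ?_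
  · have := (isKonigEgervary φ).numCoreMuCritical_add_eps_le
    rw [xi_eq, eps_eq] at this
    omega
  · let g : Fin j → Sym2 V := fun i => s(φ.symm (Sum.inl (i, 0)), φ.symm (Sum.inl (i, 3)))
    have hg : Function.Injective g := fun i i' h => by simpa [g] using h
    have hrange : (Set.range g).ncard = j := by
      rw [Set.ncard_range_of_injective hg, Nat.card_fin]
    refine hrange.ge.trans (Set.ncard_le_ncard ?_ (Set.toFinite _))
    rintro _ ⟨i, rfl⟩
    have hcrit := isMuCritical (φ := φ) i
    have h0 := symm_inl_zero_mem_core (φ := φ) i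
    exact ⟨⟨hcrit.1, _, h0, _,
      mem_nbhd.2 ⟨_, h0, SimpleGraph.Adj.symm hcrit.1⟩, rfl⟩, hcrit⟩

end pawGraph

end KonigEgervary

/-! ### Assembly of the five statements. -/

theorem mainTheorem2 {V : Type*} [Fintype V] (G : SimpleGraph V)
    (hG : KonigEgervary.IsKonigEgervary G) :
    -- (i)
    (∀ e ∈ KonigEgervary.edgesBetween G (KonigEgervary.ker G)
        (KonigEgervary.nbhd G (KonigEgervary.ker G)),
      ¬ KonigEgervary.IsMuCritical G e) ∧
    -- (ii)
    (∀ e ∈ KonigEgervary.edgesBetween G (KonigEgervary.core G \ KonigEgervary.ker G)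
        (KonigEgervary.nbhd G (KonigEgervary.ker G)),
      ¬ KonigEgervary.IsMuCritical G e) ∧
    -- (iii)
    (∀ e ∈ KonigEgervary.edgesBetween G (KonigEgervary.core G)
        (KonigEgervary.nbhd G (KonigEgervary.core G)),
      KonigEgervary.IsMuCritical G e →
        e ∈ KonigEgervary.edgesBetween G (KonigEgervary.core G \ KonigEgervary.ker G)
          (KonigEgervary.nbhd G (KonigEgervary.core G) \
            KonigEgervary.nbhd G (KonigEgervary.ker G))) ∧
    -- (iv) the upper bound, and its attainment for the given values of `ξ` and `ε`
    ((KonigEgervary.numCoreMuCritical G : ℤ) ≤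
        (KonigEgervary.xi G : ℤ) - (KonigEgervary.eps G : ℤ) ∧
      ∃ (n : ℕ) (H : SimpleGraph (Fin n)), KonigEgervary.IsKonigEgervary H ∧
        KonigEgervary.xi H = KonigEgervary.xi G ∧
        KonigEgervary.eps H = KonigEgervary.eps G ∧
        (KonigEgervary.numCoreMuCritical H : ℤ) =
          (KonigEgervary.xi G : ℤ) - (KonigEgervary.eps G : ℤ)) ∧
    -- (v)
    (KonigEgervary.rhoE G : ℤ) ≥
      (KonigEgervary.numEdges G : ℤ) - (KonigEgervary.xi G : ℤ) + (KonigEgervary.eps G : ℤ) := by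
  have hcount := hG.numCoreMuCritical_add_eps_le
  have hex := hG.exists_isCriticalIndepSet
  refine ⟨?_, ?_, fun e he hcrit => KonigEgervary.mem_edgesBetween_of_isMuCritical hex he hcrit,
    ⟨by omega, ?_⟩, ?_⟩
  · rintro e ⟨-, a, -, b, hb, rfl⟩
    exact KonigEgervary.not_isMuCritical_of_mem_nbhd_ker hex hb
  · rintro e ⟨-, a, -, b, hb, rfl⟩
    exact KonigEgervary.not_isMuCritical_of_mem_nbhd_ker hex hb
  -- There are `ξ - ε` paws and `ε` isolated vertices. The natural subtraction is exact because
  -- `hcount` gives `ε ≤ ξ`.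
  · let φ := (Fintype.equivFin ((Fin (KonigEgervary.xi G - KonigEgervary.eps G) × Fin 4) ⊕
      Fin (KonigEgervary.eps G))).symm
    refine ⟨_, KonigEgervary.pawGraph φ, KonigEgervary.pawGraph.isKonigEgervary φ, ?_,
      KonigEgervary.pawGraph.eps_eq φ, ?_⟩
    · rw [KonigEgervary.pawGraph.xi_eq φ]
      omega
    · rw [KonigEgervary.pawGraph.numCoreMuCritical_eq φ]
      omega
  · have := hG.numEdges_le_rhoE_add
    omega
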